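/- Let $\alpha=\frac{1+\sqrt5}{2}$ and, for a positive integer $t$, let $\tau(t)=\frac{\alpha^t+1}{\sqrt5}$. Nonzero numbers $x_1,\dots,x_k$ are called multiplicatively independent if the only integers $e_1,\dots,e_k$ with $x_1^{e_1}\cdots x_k^{e_k}=1$ are $e_1=\dots=e_k=0$. Let $t>0$ and $t_2>t_1>0$ be integers. Then the following hold. 1. The numbers $\alpha$ and $\tau(t)$ are multiplicatively independent if and only if $t\neq 2$. 2. The numbers $\tau(t_1)$ and $\tau(t_2)$ are multiplicatively independent. 3. The numbers $\alpha$, $\tau(t_1)$ and $\tau(t_2)$ are multiplicatively independent unless $t_1=2$, or $t_2=2$, or $(t_1,t_2)=(1,10)$; in each of these exceptional cases they are multiplicatively dependent. 4. The numbers $\alpha$, $\sqrt5$ and $\tau(t)$ are multiplicatively independent if and only if $t\notin\{1,2,10\}$. -/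

import Mathlib

/-- A finite family `x` of elements of a field is multiplicatively independent if all its members
are nonzero and the only integer exponents `e` with `∏ i, x i ^ e i = 1` are `e = 0`. -/
def MultiplicativelyIndependent {ι K : Type*} [Fintype ι] [Field K] (x : ι → K) : Prop :=
  (∀ i, x i ≠ 0) ∧ ∀ e : ι → ℤ, ∏ i, x i ^ e i = 1 → ∀ i, e i = 0

/-- The real number `τ(t) = (α ^ t + 1) / √5`, with `α = (1 + √5) / 2` the golden ratio. -/
noncomputable def tau (t : ℕ) : ℝ := (Real.goldenRatio ^ t + 1) / √5

/-! All the numbers lie in ℚ(√5), and the absolute norm carries a multiplicative relation between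
them to one between positive rationals. The unit φ has norm 1 and disappears, so it suffices that
the norms of the remaining numbers are independent; then φ^a = 1 forces a = 0.

√5 has norm 5 and τ(t) has norm N(t)/5, where N(t) = L_t + 1 + (-1)^t with L_t the Lucas number. If
t = 2k with k odd, this norm is F_k²; otherwise 5 ∤ N(t). Valuations at 5 and at one other prime
settle every case, given that N is injective (`powAddOneNorm_ne`), that F_k for odd k > j has a
prime not dividing F_j (`Nat.exists_prime_dvd_fib_not_dvd_fib`), and that for odd k the number F_k
is a power of 5 only if k is 1 or 5 (`Nat.exists_prime_ne_five_dvd_fib`).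

The exceptions come from τ(2) = φ, √5 τ(1) = φ² and τ(10) = 5φ⁵. -/

/-! ### The field ℚ(√5) and its norm -/

instance goldenField_fact : Fact (∀ r : ℚ, r ^ 2 ≠ 1 + 1 * r) := ⟨fun r hr => by
  have h : IsSquare (5 : ℚ) := ⟨2 * r - 1, by linarith⟩
  rw [show (5 : ℚ) = ((5 : ℕ) : ℚ) by norm_num, Rat.isSquare_natCast_iff] at h
  exact (Nat.prime_five.prime.not_isSquare) h⟩

/-- The field `ℚ(√5)`, with `ω` the golden ratio. -/
abbrev GoldenField : Type := QuadraticAlgebra ℚ 1 1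

namespace GoldenField

open QuadraticAlgebra

/-- The real embedding of `ℚ(√5)` that sends `ω` to the golden ratio. -/
noncomputable def toReal : GoldenField →ₐ[ℚ] ℝ :=
  lift ⟨Real.goldenRatio, by rw [← sq, Real.goldenRatio_sq]; simp [add_comm]⟩

theorem toReal_omega : toReal ω = Real.goldenRatio := by
  change (0 : ℚ) • (1 : ℝ) + (1 : ℚ) • Real.goldenRatio = Real.goldenRatio
  simp

/-- The square root of five in `ℚ(√5)`. -/
def sqrtFive : GoldenField := 2 * ω - 1

theorem toReal_sqrtFive : toReal sqrtFive = √5 := by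
  rw [sqrtFive, map_sub, map_mul, toReal_omega, map_one, map_ofNat, Real.goldenRatio]
  ring

/-- The element of `ℚ(√5)` that embeds to `tau t`. -/
noncomputable def tau (t : ℕ) : GoldenField := (ω ^ t + 1) / sqrtFive

theorem toReal_tau (t : ℕ) : toReal (tau t) = _root_.tau t := by
  rw [tau, _root_.tau, map_div₀, toReal_sqrtFive, map_add, map_pow, toReal_omega, map_one]

/-- The absolute value of the norm of `ℚ(√5)` over `ℚ`. -/
def absNorm : GoldenField →*₀ ℚ where
  toFun x := |QuadraticAlgebra.norm x|
  map_zero' := by simp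
  map_one' := by simp
  map_mul' x y := by rw [map_mul, abs_mul]

theorem absNorm_apply (x : GoldenField) : absNorm x = |QuadraticAlgebra.norm x| := rfl

/-- The real embedding is injective, so the relation already holds in ℚ(√5), where the norm is
multiplicative. -/
theorem absNorm_relation {x y z : GoldenField} {a b c : ℤ}
    (h : toReal x ^ a * toReal y ^ b * toReal z ^ c = 1) :
    absNorm x ^ a * absNorm y ^ b * absNorm z ^ c = 1 := by
  have hK : x ^ a * y ^ b * z ^ c = 1 :=
    (toReal : GoldenField →+* ℝ).injective (by simpa using h)
  simpa using congrArg absNorm hK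

theorem absNorm_omega : absNorm ω = 1 := by
  simp [absNorm_apply, norm_def]

theorem absNorm_sqrtFive : absNorm sqrtFive = 5 := by
  have : sqrtFive = ⟨-1, 2⟩ := by
    rw [sqrtFive, two_mul]
    ext <;> simp
    norm_num
  rw [absNorm_apply, this, norm_def]; norm_num

theorem omega_pow_succ (n : ℕ) :
    (ω : GoldenField) ^ (n + 1) = ⟨Nat.fib n, Nat.fib (n + 1)⟩ := by
  induction n with
  | zero => ext <;> simp
  | succ n ih =>
    rw [pow_succ, ih, Nat.fib_add_two]
    ext <;> simp

end GoldenField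

/-! ### Arithmetic of the norm of φ^t + 1 -/

/-- The absolute value of the norm of `φ ^ t + 1`, where `φ` is the golden ratio and `0 < t`. -/
def powAddOneNorm (t : ℕ) : ℕ :=
  2 * Nat.fib (t - 1) + Nat.fib t + if Even t then 2 else 0

theorem Nat.fib_cassini (n : ℕ) :
    (Nat.fib (n + 1) : ℤ) ^ 2 - Nat.fib (n + 1) * Nat.fib n - (Nat.fib n) ^ 2 = (-1) ^ n := by
  induction n with
  | zero => simp
  | succ n ih =>
    rw [Nat.fib_add_two, pow_succ _ n, ← ih]
    push_cast
    ring

namespace GoldenField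

open QuadraticAlgebra

/-- The norm of x + yω is x² + xy - y². For x = F_{t-1} + 1 and y = F_t, Cassini reduces the
quadratic part in the Fibonacci numbers to (-1)^t, leaving L_t = 2F_{t-1} + F_t and 1. -/
theorem norm_omega_pow_add_one {t : ℕ} (ht : 0 < t) :
    QuadraticAlgebra.norm ((ω : GoldenField) ^ t + 1) = (powAddOneNorm t : ℚ) := by
  obtain ⟨n, rfl⟩ : ∃ n, t = n + 1 := ⟨t - 1, by omega⟩
  have hc : (Nat.fib (n + 1) : ℚ) ^ 2 - Nat.fib (n + 1) * Nat.fib n - (Nat.fib n) ^ 2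
      = (-1) ^ n := mod_cast Nat.fib_cassini n
  rw [omega_pow_succ, norm_def, powAddOneNorm]
  rcases Nat.even_or_odd n with hn | hn
  · rw [hn.neg_one_pow] at hc
    rw [if_neg (by simpa [Nat.even_add_one] using hn)]
    simp
    linarith
  · rw [hn.neg_one_pow] at hc
    rw [if_pos (by simpa [Nat.even_add_one] using hn)]
    simp
    linarith

theorem absNorm_tau {t : ℕ} (ht : 0 < t) : absNorm (tau t) = powAddOneNorm t / 5 := by
  rw [tau, map_div₀, absNorm_sqrtFive, absNorm_apply, norm_omega_pow_add_one ht, Nat.abs_cast]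

end GoldenField

/-- Behind this is τ(2k) = F_k φ^k for odd k, because then φ^(-k) = -ψ^k for the conjugate ψ of φ.
-/
theorem powAddOneNorm_two_mul {k : ℕ} (hk : Odd k) :
    powAddOneNorm (2 * k) = 5 * Nat.fib k ^ 2 := by
  obtain ⟨j, rfl⟩ : ∃ j, k = j + 1 := ⟨k - 1, by have := hk.pos; omega⟩
  have hj : Even j := by simpa [Nat.even_add_one, Nat.odd_add_one] using hk
  have hc := Nat.fib_cassini j
  rw [hj.neg_one_pow] at hc
  have h1 := Nat.fib_two_mul_add_one j
  have h2 := Nat.fib_two_mul_add_two j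
  rw [powAddOneNorm, if_pos (even_two_mul _), show 2 * (j + 1) - 1 = 2 * j + 1 by omega,
    show 2 * (j + 1) = 2 * j + 2 by ring, h1, h2]
  zify
  linarith

theorem not_five_dvd_powAddOneNorm {t : ℕ} (ht : 0 < t) (h : t % 4 ≠ 2) :
    ¬ 5 ∣ powAddOneNorm t := by
  -- Lucas numbers modulo 5 have period 4. Adding 2 at even indices gives 0 only at t ≡ 2 mod 4.
  have key (n : ℕ) : (2 * Nat.fib n + Nat.fib (n + 1)) % 5 =
      if n % 4 = 0 then 1 else if n % 4 = 1 then 3 else if n % 4 = 2 then 4 else 2 := by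
    induction n using Nat.strong_induction_on with
    | _ n ih =>
      match n with
      | 0 | 1 | 2 | 3 => decide
      | n + 4 =>
        have := ih n (by omega)
        have h2 : Nat.fib (n + 2) = Nat.fib n + Nat.fib (n + 1) := Nat.fib_add_two
        have h3 : Nat.fib (n + 3) = Nat.fib (n + 1) + Nat.fib (n + 2) := Nat.fib_add_two
        have h4 : Nat.fib (n + 4) = Nat.fib (n + 2) + Nat.fib (n + 3) := Nat.fib_add_two
        have h5 : Nat.fib (n + 4 + 1) = Nat.fib (n + 3) + Nat.fib (n + 4) := Nat.fib_add_two
        rw [Nat.add_mod_right, ← this]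
        omega
  obtain ⟨n, rfl⟩ : ∃ n, t = n + 1 := ⟨t - 1, by omega⟩
  have := key n
  rw [powAddOneNorm, Nat.add_sub_cancel]
  simp only [Nat.even_iff]
  split_ifs at this ⊢ <;> omega

/-- The increment L_{t-1} is at least 3, which outweighs the 2 lost when t is even. Monotonicity
fails at t = 2, since N(2) = 5 and N(3) = 4. -/
theorem powAddOneNorm_lt_succ {t : ℕ} (ht : 3 ≤ t) :
    powAddOneNorm t < powAddOneNorm (t + 1) := by
  obtain ⟨n, rfl⟩ : ∃ n, t = n + 3 := ⟨t - 3, by omega⟩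
  have h2 : Nat.fib (n + 3 + 1) = Nat.fib (n + 2) + Nat.fib (n + 3) := Nat.fib_add_two
  have h3 : Nat.fib (n + 3) = Nat.fib (n + 1) + Nat.fib (n + 2) := Nat.fib_add_two
  have h4 : 0 < Nat.fib (n + 1) := Nat.fib_pos.2 (by omega)
  have h5 : 0 < Nat.fib (n + 2) := Nat.fib_pos.2 (by omega)
  simp only [powAddOneNorm, Nat.add_sub_cancel, show n + 3 - 1 = n + 2 by omega]
  split_ifs with ha hb
  · exact absurd hb (by simpa [Nat.even_add_one] using ha)
  all_goals omega

theorem powAddOneNorm_lt {s t : ℕ} (hs : 3 ≤ s) (hst : s < t) :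
    powAddOneNorm s < powAddOneNorm t := by
  induction t, hst using Nat.le_induction with
  | base => exact powAddOneNorm_lt_succ hs
  | succ t ht ih => exact ih.trans (powAddOneNorm_lt_succ (by omega))

theorem powAddOneNorm_ne {s t : ℕ} (hs : 0 < s) (hst : s < t) :
    powAddOneNorm s ≠ powAddOneNorm t := by
  have h4 : powAddOneNorm 4 = 9 := by decide
  have h3 : powAddOneNorm 3 = 4 := by decide
  have h2 : powAddOneNorm 2 = 5 := by decide
  have h1 : powAddOneNorm 1 = 1 := by decide
  rcases Nat.lt_or_ge s 3 with hs3 | hs3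
  · obtain rfl | rfl : s = 1 ∨ s = 2 := by omega
    all_goals
      rcases Nat.lt_or_ge t 4 with ht | ht
      · interval_cases t <;> omega
      · rcases ht.eq_or_lt with rfl | ht
        · omega
        · have := powAddOneNorm_lt (by norm_num : 3 ≤ 4) ht
          omega
  · exact (powAddOneNorm_lt hs3 hst).ne

/-! ### Prime divisors of Fibonacci numbers of odd index -/

/-- The quotients `F (g * m) / F g` of Fibonacci numbers satisfy a linear recurrence whose
reduction modulo `F g ^ 2` is a geometric sum. -/
theorem Nat.fib_mul_eq_fib_mul_geom_sum (g m : ℕ) : ∃ a : ℕ,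
    Nat.fib ((g + 1) * m) = Nat.fib (g + 1) * a ∧ (3 ≤ g + 1 → 2 ≤ m → m < a) ∧
    (Nat.fib (g + 1) : ℤ) ^ 2 ∣ a - ∑ i ∈ Finset.range m,
      ((Nat.fib g : ℤ) + Nat.fib (g + 1)) ^ i * (Nat.fib g : ℤ) ^ (m - 1 - i) := by
  set F := Nat.fib (g + 1) with hF
  set h := Nat.fib g
  have hG : Nat.fib (g + 2) = h + F := Nat.fib_add_two
  -- In the addition formula for F_{(g+1)(m+1)+1}, the term F_{(g+1)m} · F is divisible by F², so
  -- modulo F² each step multiplies by F_{g+2} = h + F.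
  have hB (m : ℕ) : (F : ℤ) ^ 2 ∣ Nat.fib ((g + 1) * m + 1) - ((h : ℤ) + F) ^ m ∧
      F ∣ Nat.fib ((g + 1) * m) := by
    induction m with
    | zero => simp
    | succ m ih =>
      obtain ⟨⟨u, hu⟩, v, hv⟩ := ih
      have e1 : Nat.fib ((g + 1) * (m + 1) + 1) =
          Nat.fib ((g + 1) * m) * F + Nat.fib ((g + 1) * m + 1) * (h + F) := by
        rw [show (g + 1) * (m + 1) + 1 = (g + 1) * m + (g + 1) + 1 by ring, Nat.fib_add, hG]
      refine ⟨⟨v + u * (h + F), ?_⟩, Nat.fib_dvd _ _ (dvd_mul_right _ _)⟩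
      rw [e1, hv]
      push_cast
      rw [sub_eq_iff_eq_add] at hu
      rw [hu]
      ring
  induction m with
  | zero => exact ⟨0, by simp⟩
  | succ m ih =>
    obtain ⟨a, ha, hlt, u, hu⟩ := ih
    obtain ⟨v, hv⟩ := (hB m).1
    -- The addition formula for F_{(g+1)m+g+1}, divided by F.
    refine ⟨h * a + Nat.fib ((g + 1) * m + 1), ?_, ?_, h * u + v, ?_⟩
    · rw [show (g + 1) * (m + 1) = (g + 1) * m + g + 1 by ring, Nat.fib_add, ha]
      ring
    · intro hg hm
      have h1 : 1 ≤ h := Nat.fib_pos.2 (by omega)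
      have h2 : 2 ≤ Nat.fib ((g + 1) * m + 1) := by
        refine le_trans (b := Nat.fib 3) (by decide) (Nat.fib_mono ?_)
        nlinarith
      have h3 : 1 * a ≤ h * a := Nat.mul_le_mul_right _ h1
      rcases Nat.lt_or_ge m 2 with hm2 | hm2
      · obtain rfl : m = 1 := by omega
        have : a ≠ 0 := by
          rintro rfl
          simp at ha
        omega
      · have := hlt hg hm2
        omega
    · rw [sub_eq_iff_eq_add] at hu hv
      push_cast
      rw [hu, hv, Finset.sum_range_succ, Nat.sub_self, pow_zero, mul_one]
      have : ∑ i ∈ Finset.range m, ((h : ℤ) + F) ^ i * (h : ℤ) ^ (m - i) =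
          h * ∑ i ∈ Finset.range m, ((h : ℤ) + F) ^ i * (h : ℤ) ^ (m - 1 - i) := by
        rw [Finset.mul_sum]
        refine Finset.sum_congr rfl fun i hi => ?_
        have := Finset.mem_range.1 hi
        rw [show m - i = m - 1 - i + 1 by omega, pow_succ]
        ring
      rw [this]
      ring

/-- For an odd prime `q` and odd `g`, some prime divides `F (g * q)` but not `F g`. -/
theorem Nat.exists_prime_dvd_fib_mul_prime {g q : ℕ} (hg : Odd g) (hq : q.Prime) (hq2 : Odd q) :
    ∃ p, p.Prime ∧ p ∣ Nat.fib (g * q) ∧ ¬ p ∣ Nat.fib g := by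
  by_contra! hno
  obtain ⟨n, rfl⟩ : ∃ n, g = n + 1 := ⟨g - 1, by have := hg.pos; omega⟩
  have hq3 : 3 ≤ q := by
    have := hq.two_le
    obtain ⟨r, rfl⟩ := hq2
    omega
  have hn : 3 ≤ n + 1 := by
    by_contra hlt
    obtain rfl : n = 0 := by
      obtain ⟨r, hr⟩ := hg
      omega
    have h2 : 2 ≤ Nat.fib ((0 + 1) * q) :=
      le_trans (b := Nat.fib 3) (by decide) (Nat.fib_mono (by omega))
    obtain ⟨p, hp, hpd⟩ := Nat.exists_prime_and_dvd (n := Nat.fib ((0 + 1) * q)) (by omega)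
    have := hno p hp hpd
    simp at this
    exact hp.one_lt.ne' this
  obtain ⟨a, ha, hlt, hdvd⟩ := Nat.fib_mul_eq_fib_mul_geom_sum n q
  have hlt := hlt hn hq.two_le
  set F := Nat.fib (n + 1) with hF
  set h := Nat.fib n
  have hcop : Nat.Coprime h F := Nat.fib_coprime_fib_succ n
  -- Such a p divides F, so modulo p all q terms of the sum equal h^(q-1), with h prime to p; hence
  -- p divides q.
  have hpq : ∀ p : ℕ, p.Prime → p ∣ a → p = q := by
    intro p hp hpa
    have hpF : p ∣ F := hno p hp (ha ▸ hpa.mul_left _)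
    have hpF' : (p : ℤ) ∣ F := mod_cast hpF
    have hgeom : (p : ℤ) ∣ ∑ i ∈ Finset.range q, ((h : ℤ) + F) ^ i * (h : ℤ) ^ (q - 1 - i) := by
      have h1 : (p : ℤ) ∣ a := mod_cast hpa
      have := ((hpF'.trans (dvd_pow_self _ two_ne_zero)).trans hdvd)
      exact (dvd_sub_right h1).1 this
    have hco : IsCoprime (p : ℤ) h := by
      rw [Nat.isCoprime_iff_coprime]
      exact (hcop.coprime_dvd_right hpF).symm
    rw [dvd_geom_sum₂_iff_of_dvd_sub (by simpa using hpF')] at hgeom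
    have := (hco.pow_right (n := q - 1)).dvd_of_dvd_mul_right hgeom
    exact (Nat.prime_dvd_prime_iff_eq hp hq).1 (mod_cast this)
  have hqa : q ∣ a := by
    obtain ⟨p, hp, hpa⟩ := Nat.exists_prime_and_dvd (n := a) (by omega)
    exact hpq p hp hpa ▸ hpa
  have hqF : q ∣ F := hno q hq (ha ▸ hqa.mul_left _)
  -- Since q is odd and divides F, the sum is q h^(q-1) modulo q²; so q² ∣ a would give q ∣ h,
  -- although h and F are coprime.
  have hq2a : ¬ q ^ 2 ∣ a := by
    intro hd
    obtain ⟨f, hf⟩ := hqF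
    have h1 := odd_sq_dvd_geom_sum₂_sub (h : ℤ) (f : ℤ) hq2
    have h2 : ((q : ℤ)) ^ 2 ∣ (F : ℤ) ^ 2 := pow_dvd_pow_of_dvd (by rw [hf]; simp) 2
    have h3 := h2.trans hdvd
    have h4 : ((q : ℤ)) ^ 2 ∣ a := mod_cast hd
    have h5 := (dvd_sub_right h4).1 h3
    have hf' : (F : ℤ) = q * f := by rw [hf]; push_cast; rfl
    rw [hf'] at h5
    have h6 := (dvd_sub_right h5).1 h1
    have h7 : q * q ∣ q * h ^ (q - 1) := by
      rw [← sq]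
      exact_mod_cast h6
    have h8 : q ∣ h := hq.dvd_of_dvd_pow (Nat.dvd_of_mul_dvd_mul_left hq.pos h7)
    exact Nat.Prime.not_coprime_iff_dvd.2 ⟨q, hq, h8, hf ▸ dvd_mul_right _ _⟩ hcop
  -- Hence a is 1 or q, contradicting q < a.
  have hpow : a = q ^ a.primeFactorsList.length :=
    Nat.eq_prime_pow_of_unique_prime_dvd (by omega) fun {p} hp hpa => hpq p hp hpa
  have hle : a.primeFactorsList.length ≤ 1 := by
    by_contra hl
    exact hq2a (hpow ▸ pow_dvd_pow q (by omega))
  have : q ^ a.primeFactorsList.length ≤ q ^ 1 := Nat.pow_le_pow_right hq.pos hle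
  rw [pow_one] at this
  omega

/-- Put d = gcd(j, k), a proper divisor of k, and let q be a prime factor of k/d. A prime dividing
F_{dq} but not F_d divides F_k; it cannot divide F_j, because gcd(F_j, F_k) = F_d. -/
theorem Nat.exists_prime_dvd_fib_not_dvd_fib {j k : ℕ} (hj : 0 < j) (hk : Odd k) (hjk : j < k) :
    ∃ p, p.Prime ∧ p ∣ Nat.fib k ∧ ¬ p ∣ Nat.fib j := by
  have hgk : Nat.gcd j k ∣ k := Nat.gcd_dvd_right j k
  obtain ⟨m, hm⟩ := hgk
  have hgj : Nat.gcd j k ≤ j := Nat.gcd_le_left _ hj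
  have hm1 : m ≠ 1 := by
    rintro rfl
    omega
  obtain ⟨q, hq, r, rfl⟩ := Nat.exists_prime_and_dvd hm1
  have hodd := hm ▸ hk
  rw [Nat.odd_mul, Nat.odd_mul] at hodd
  obtain ⟨p, hp, hpd, hpn⟩ := Nat.exists_prime_dvd_fib_mul_prime hodd.1 hq hodd.2.1
  have hpk : p ∣ Nat.fib k := hpd.trans (Nat.fib_dvd _ _ ⟨r, by rw [mul_assoc, ← hm]⟩)
  refine ⟨p, hp, hpk, fun hpj => hpn ?_⟩
  rw [Nat.fib_gcd]
  exact Nat.dvd_gcd hpj hpk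

/-- If F_k is a power of 5 and k ≥ 6, then 25 ∣ F_k. As 25 ∣ F_25, it divides F_{gcd(25, k)}, which
forces 25 ∣ k. But F_25 = 25 · 3001, so 3001 ∣ F_k. -/
theorem Nat.exists_prime_ne_five_dvd_fib {k : ℕ} (hk : Odd k) (h1 : k ≠ 1) (h5 : k ≠ 5) :
    ∃ p, p.Prime ∧ p ≠ 5 ∧ p ∣ Nat.fib k := by
  by_contra! hno
  have h3 : 3 ≤ k := by
    obtain ⟨r, rfl⟩ := hk
    omega
  have hpos : Nat.fib k ≠ 0 := (Nat.fib_pos.2 (by omega)).ne'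
  have hpow : Nat.fib k = 5 ^ (Nat.fib k).primeFactorsList.length :=
    Nat.eq_prime_pow_of_unique_prime_dvd hpos fun {p} hp hpa => by
      by_contra hne
      exact hno p hp hne hpa
  rcases Nat.lt_or_ge k 6 with hlt | hge
  · obtain rfl : k = 3 := by
      obtain ⟨r, rfl⟩ := hk
      omega
    exact hno 2 Nat.prime_two (by norm_num) (by decide)
  have h8 : 8 ≤ Nat.fib k := le_trans (b := Nat.fib 6) (by decide) (Nat.fib_mono hge)
  have h25 : 5 ^ 2 ∣ Nat.fib k := by
    rw [hpow]
    refine pow_dvd_pow 5 ?_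
    by_contra hl
    have : 5 ^ (Nat.fib k).primeFactorsList.length ≤ 5 ^ 1 :=
      Nat.pow_le_pow_right (by norm_num) (by omega)
    omega
  have hg : 25 ∣ Nat.fib (Nat.gcd 25 k) := by
    rw [Nat.fib_gcd]
    exact Nat.dvd_gcd (by rw [Nat.fib_eq_fastFib]; decide) h25
  have h25k : Nat.gcd 25 k = 25 := by
    have hd : Nat.gcd 25 k ∈ Nat.divisors 25 :=
      Nat.mem_divisors.2 ⟨Nat.gcd_dvd_left _ _, by norm_num⟩
    rw [show Nat.divisors 25 = {1, 5, 25} by decide] at hd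
    simp only [Finset.mem_insert, Finset.mem_singleton] at hd
    rcases hd with hd | hd | hd
    · rw [hd] at hg; exact absurd hg (by decide)
    · rw [hd] at hg; exact absurd hg (by decide)
    · exact hd
  refine hno 3001 (by norm_num) (by norm_num) (Dvd.dvd.trans ?_ (Nat.fib_dvd 25 k ?_))
  · rw [Nat.fib_eq_fastFib]; decide
  · exact h25k ▸ Nat.gcd_dvd_right 25 k

/-! ### Relations between rationals through valuations -/

/-- Two numbers without nontrivial multiplicative relation. -/
def IndependentPair (x y : ℚ) : Prop :=
  ∀ a b : ℤ, x ^ a * y ^ b = 1 → a = 0 ∧ b = 0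

theorem IndependentPair.symm {x y : ℚ} (h : IndependentPair x y) : IndependentPair y x :=
  fun a b hab => (h b a (by rwa [mul_comm])).symm

theorem padicValRat_relation {x y : ℚ} (hx : x ≠ 0) (hy : y ≠ 0) {a b : ℤ}
    (h : x ^ a * y ^ b = 1) (p : ℕ) [Fact p.Prime] :
    a * padicValRat p x + b * padicValRat p y = 0 := by
  have := congrArg (padicValRat p) h
  rwa [padicValRat.mul (zpow_ne_zero _ hx) (zpow_ne_zero _ hy), padicValRat.zpow,
    padicValRat.zpow, padicValRat.one] at this

theorem padicValRat_five_div_five {m : ℕ} (hm : ¬ 5 ∣ m) :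
    haveI : Fact (Nat.Prime 5) := ⟨Nat.prime_five⟩
    padicValRat 5 ((m : ℚ) / 5) = -1 := by
  have : Fact (Nat.Prime 5) := ⟨Nat.prime_five⟩
  have hm0 : (m : ℚ) ≠ 0 := by
    rintro h
    exact hm (by simp [Nat.cast_eq_zero.1 h])
  have h5 : padicValRat 5 (5 : ℚ) = 1 := mod_cast padicValRat.self (p := 5) (by norm_num)
  rw [padicValRat.div hm0 (by norm_num), h5, padicValRat.of_nat,
    padicValNat.eq_zero_of_not_dvd hm]
  simp

theorem padicValRat_div_five {m p : ℕ} [Fact p.Prime] (hp : p ≠ 5) (hm : m ≠ 0) :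
    padicValRat p ((m : ℚ) / 5) = padicValNat p m := by
  have h5 : padicValRat p ((5 : ℕ) : ℚ) = 0 := by
    rw [padicValRat.of_nat, padicValNat.eq_zero_of_not_dvd]
    · rfl
    · exact fun h => hp ((Nat.prime_dvd_prime_iff_eq Fact.out Nat.prime_five).1 h)
  rw [padicValRat.div (mod_cast hm) (by norm_num), padicValRat.of_nat]
  rw [Nat.cast_ofNat] at h5
  rw [h5, sub_zero]

theorem padicValNat_cast_pos {p n : ℕ} (hp : p.Prime) (hn : n ≠ 0) (h : p ∣ n) :
    0 < (padicValNat p n : ℤ) :=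
  have := Fact.mk hp
  mod_cast one_le_padicValNat_of_dvd hn h

/-- Both 5-adic valuations are -1, so the exponents are opposite and the relation becomes (m/n)^a =
1. -/
theorem independentPair_div_five_div_five {m n : ℕ} (hm : ¬ 5 ∣ m) (hn : ¬ 5 ∣ n) (hmn : m ≠ n) :
    IndependentPair ((m : ℚ) / 5) ((n : ℚ) / 5) := by
  intro a b h
  have hm0 : (0 : ℚ) < m := by
    rw [Nat.cast_pos]; exact Nat.pos_of_ne_zero fun h0 => hm (h0 ▸ dvd_zero _)
  have hn0 : (0 : ℚ) < n := by
    rw [Nat.cast_pos]; exact Nat.pos_of_ne_zero fun h0 => hn (h0 ▸ dvd_zero _)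
  have : Fact (Nat.Prime 5) := ⟨Nat.prime_five⟩
  have h5 := padicValRat_relation (by positivity) (by positivity) h 5
  rw [padicValRat_five_div_five hm, padicValRat_five_div_five hn] at h5
  obtain rfl : b = -a := by linarith
  rw [zpow_neg, ← div_eq_mul_inv, ← div_zpow, div_div_div_cancel_right₀ (by norm_num)] at h
  suffices a = 0 by simp [this]
  by_contra ha
  have := (zpow_eq_one_iff_right₀ (by positivity) (fun h1 => hmn ?_)).1 h
  · exact ha this
  · rw [div_eq_one_iff_eq hn0.ne'] at h1
    exact_mod_cast h1

/-- The valuation at 5 gives a = b v_5(n); at a prime p ≠ 5 one gets b (v_5(n) v_p(m) + v_p(n)) = 0.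
The last hypothesis provides a p with positive bracket: it rules out m = 1 with n a power of 5. -/
theorem independentPair_div_five_natCast {m n : ℕ} (hm : ¬ 5 ∣ m) (hn : 1 < n)
    (h : m ≠ 1 ∨ ∃ p, p.Prime ∧ p ≠ 5 ∧ p ∣ n) :
    IndependentPair ((m : ℚ) / 5) (n : ℚ) := by
  intro a b hab
  have hm0 : m ≠ 0 := fun h0 => hm (h0 ▸ dvd_zero _)
  have hn0 : n ≠ 0 := by omega
  have hmq : (m : ℚ) / 5 ≠ 0 := by positivity
  have hnq : (n : ℚ) ≠ 0 := by positivity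
  have hrel (p : ℕ) (hp : p.Prime) (hp5 : p ≠ 5) :
      a * (padicValNat p m : ℤ) + b * padicValNat p n = 0 := by
    have := Fact.mk hp
    have := padicValRat_relation hmq hnq hab p
    rwa [padicValRat_div_five hp5 hm0, padicValRat.of_nat] at this
  have : Fact (Nat.Prime 5) := ⟨Nat.prime_five⟩
  have h5 := padicValRat_relation hmq hnq hab 5
  rw [padicValRat_five_div_five hm, padicValRat.of_nat] at h5
  have ha : a = b * padicValNat 5 n := by linarith
  suffices b = 0 by simp [ha, this]
  have key : ∃ p, p.Prime ∧ p ≠ 5 ∧ (p ∣ m ∧ 5 ∣ n ∨ p ∣ n) := by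
    rcases h with h | ⟨p, hp, hp5, hpn⟩
    · by_cases hd : 5 ∣ n
      · obtain ⟨p, hp, hpm⟩ := Nat.exists_prime_and_dvd h
        exact ⟨p, hp, fun h => hm (h ▸ hpm), Or.inl ⟨hpm, hd⟩⟩
      · obtain ⟨p, hp, hpn⟩ := Nat.exists_prime_and_dvd hn.ne'
        exact ⟨p, hp, fun h => hd (h ▸ hpn), Or.inr hpn⟩
    · exact ⟨p, hp, hp5, Or.inr hpn⟩
  obtain ⟨p, hp, hp5, hpd⟩ := key
  have hr := hrel p hp hp5
  rw [ha, mul_assoc, ← mul_add] at hr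
  refine (mul_eq_zero.1 hr).resolve_right (ne_of_gt ?_)
  rcases hpd with ⟨hpm, hd⟩ | hpn
  · have := padicValNat_cast_pos hp hm0 hpm
    have := padicValNat_cast_pos Nat.prime_five hn0 hd
    positivity
  · have := padicValNat_cast_pos hp hn0 hpn
    positivity

theorem independentPair_natCast {m n : ℕ} (hm : 1 < m) (hn : n ≠ 0)
    (h : ∃ p, p.Prime ∧ p ∣ n ∧ ¬ p ∣ m) : IndependentPair (m : ℚ) (n : ℚ) := by
  intro a b hab
  have hm0 : m ≠ 0 := by omega
  have hrel (p : ℕ) (hp : p.Prime) : a * (padicValNat p m : ℤ) + b * padicValNat p n = 0 := by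
    have := Fact.mk hp
    have := padicValRat_relation (mod_cast hm0) (mod_cast hn) hab p
    rwa [padicValRat.of_nat, padicValRat.of_nat] at this
  obtain ⟨p, hp, hpn, hpm⟩ := h
  have h1 := hrel p hp
  rw [padicValNat.eq_zero_of_not_dvd hpm, Nat.cast_zero, mul_zero, zero_add] at h1
  have hb : b = 0 := (mul_eq_zero.1 h1).resolve_right (padicValNat_cast_pos hp hn hpn).ne'
  obtain ⟨q, hq, hqm⟩ := Nat.exists_prime_and_dvd hm.ne'
  have h2 := hrel q hq
  rw [hb, zero_mul, add_zero] at h2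
  exact ⟨(mul_eq_zero.1 h2).resolve_right (padicValNat_cast_pos hq hm0 hqm).ne', hb⟩

/-! ### Independence of the norms -/

theorem absNorm_tau_two_mul {k : ℕ} (hk : Odd k) :
    GoldenField.absNorm (GoldenField.tau (2 * k)) = ((Nat.fib k ^ 2 : ℕ) : ℚ) := by
  rw [GoldenField.absNorm_tau (by have := hk.pos; omega), powAddOneNorm_two_mul hk]
  push_cast
  ring

theorem one_lt_fib_sq {k : ℕ} (hk : 3 ≤ k) : 1 < Nat.fib k ^ 2 := by
  have : 2 ≤ Nat.fib k := le_trans (b := Nat.fib 3) (by decide) (Nat.fib_mono hk)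
  nlinarith

theorem exists_odd_of_mod_four_eq_two {t : ℕ} (h : t % 4 = 2) : ∃ k, Odd k ∧ t = 2 * k :=
  ⟨t / 2, Nat.odd_iff.2 (by omega), by omega⟩

theorem powAddOneNorm_ne_one {t : ℕ} (ht : 1 < t) : powAddOneNorm t ≠ 1 :=
  (powAddOneNorm_ne one_pos ht).symm

/-- The cases are whether s and t are 2 mod 4. The exclusions are needed: τ(2) has norm 1, and τ(1),
τ(10) have norms 1/5 and 25. -/
theorem independentPair_absNorm_tau {s t : ℕ} (hs : 0 < s) (hst : s < t)
    (h : ¬ (s = 2 ∨ t = 2 ∨ (s = 1 ∧ t = 10))) :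
    IndependentPair (GoldenField.absNorm (GoldenField.tau s))
      (GoldenField.absNorm (GoldenField.tau t)) := by
  by_cases hs4 : s % 4 = 2
  · obtain ⟨j, hj, rfl⟩ := exists_odd_of_mod_four_eq_two hs4
    have hj3 : 3 ≤ j := by
      obtain ⟨r, rfl⟩ := hj
      omega
    rw [absNorm_tau_two_mul hj]
    by_cases ht4 : t % 4 = 2
    · obtain ⟨k, hk, rfl⟩ := exists_odd_of_mod_four_eq_two ht4
      rw [absNorm_tau_two_mul hk]
      obtain ⟨p, hp, hpk, hpj⟩ :=
        Nat.exists_prime_dvd_fib_not_dvd_fib hj.pos hk (by omega : j < k)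
      exact independentPair_natCast (one_lt_fib_sq hj3)
        (pow_ne_zero 2 (Nat.fib_pos.2 hk.pos).ne')
        ⟨p, hp, dvd_pow hpk two_ne_zero, fun hd => hpj (hp.dvd_of_dvd_pow hd)⟩
    · rw [GoldenField.absNorm_tau (by omega)]
      exact (independentPair_div_five_natCast (not_five_dvd_powAddOneNorm (by omega) ht4)
        (one_lt_fib_sq hj3) (Or.inl (powAddOneNorm_ne_one (by omega)))).symm
  · have h5 := not_five_dvd_powAddOneNorm hs hs4
    rw [GoldenField.absNorm_tau hs]
    by_cases ht4 : t % 4 = 2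
    · obtain ⟨k, hk, rfl⟩ := exists_odd_of_mod_four_eq_two ht4
      have hk3 : 3 ≤ k := by
        obtain ⟨r, rfl⟩ := hk
        omega
      rw [absNorm_tau_two_mul hk]
      refine independentPair_div_five_natCast h5 (one_lt_fib_sq hk3) ?_
      by_cases hs1 : s = 1
      · obtain ⟨p, hp, hp5, hpd⟩ := Nat.exists_prime_ne_five_dvd_fib hk (by omega) (by omega)
        exact Or.inr ⟨p, hp, hp5, dvd_pow hpd two_ne_zero⟩
      · exact Or.inl (powAddOneNorm_ne_one (by omega))
    · rw [GoldenField.absNorm_tau (by omega)]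
      exact independentPair_div_five_div_five h5 (not_five_dvd_powAddOneNorm (by omega) ht4)
        (powAddOneNorm_ne hs hst)

theorem independentPair_five_absNorm_tau {t : ℕ} (ht : 0 < t)
    (h : ¬ (t = 1 ∨ t = 2 ∨ t = 10)) :
    IndependentPair 5 (GoldenField.absNorm (GoldenField.tau t)) := by
  rw [← Nat.cast_ofNat (n := 5)]
  by_cases ht4 : t % 4 = 2
  · obtain ⟨k, hk, rfl⟩ := exists_odd_of_mod_four_eq_two ht4
    rw [absNorm_tau_two_mul hk]
    obtain ⟨p, hp, hp5, hpd⟩ := Nat.exists_prime_ne_five_dvd_fib hk (by omega) (by omega)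
    exact independentPair_natCast (by norm_num) (pow_ne_zero 2 (Nat.fib_pos.2 hk.pos).ne')
      ⟨p, hp, dvd_pow hpd two_ne_zero,
        fun h => hp5 ((Nat.prime_dvd_prime_iff_eq hp Nat.prime_five).1 h)⟩
  · rw [GoldenField.absNorm_tau ht]
    exact (independentPair_div_five_natCast (not_five_dvd_powAddOneNorm ht ht4) (by norm_num)
      (Or.inl (powAddOneNorm_ne_one (by omega)))).symm

theorem absNorm_tau_ne_one {t : ℕ} (ht : 0 < t) (h2 : t ≠ 2) :
    GoldenField.absNorm (GoldenField.tau t) ≠ 1 := by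
  rw [GoldenField.absNorm_tau ht]
  intro h
  rw [div_eq_one_iff_eq (by norm_num)] at h
  have h5 : powAddOneNorm t = powAddOneNorm 2 := by
    rw [show powAddOneNorm 2 = 5 by decide]
    exact_mod_cast h
  rcases Nat.lt_or_gt_of_ne h2 with hlt | hlt
  · exact powAddOneNorm_ne ht hlt h5
  · exact powAddOneNorm_ne two_pos hlt h5.symm

/-! ### Explicit relations for t = 1, 2, 10 -/

theorem tau_pos (t : ℕ) : 0 < tau t := by
  have := Real.goldenRatio_pos
  rw [tau]
  positivity

theorem tau_two : tau 2 = Real.goldenRatio := by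
  rw [tau, div_eq_iff (by positivity), ← Real.goldenRatio_sub_goldenConj, mul_sub,
    Real.goldenRatio_mul_goldenConj]
  ring

theorem sqrt_five_mul_tau_one : √5 * tau 1 = Real.goldenRatio ^ 2 := by
  rw [tau, mul_div_cancel₀ _ (by positivity), Real.goldenRatio_sq, pow_one]

theorem tau_ten : tau 10 = 5 * Real.goldenRatio ^ 5 := by
  have h := Real.goldenRatio_sq
  have h5 : √5 = 2 * Real.goldenRatio - 1 := by rw [Real.goldenRatio]; ring
  have e5 : Real.goldenRatio ^ 5 = 5 * Real.goldenRatio + 3 := by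
    -- The coefficient is the quotient of X⁵ - 5X - 3 by X² - X - 1.
    linear_combination (Real.goldenRatio ^ 3 + Real.goldenRatio ^ 2 + 2 * Real.goldenRatio + 3) * h
  rw [tau, div_eq_iff (by positivity), show Real.goldenRatio ^ 10 = (Real.goldenRatio ^ 5) ^ 2 by
    ring, e5, h5]
  linear_combination -25 * h

theorem zpow_goldenRatio_eq_one {a : ℤ} (h : Real.goldenRatio ^ a = 1) : a = 0 :=
  (zpow_eq_one_iff_right₀ Real.goldenRatio_pos.le Real.one_lt_goldenRatio.ne').1 h

/-! ### From norms back to real numbers -/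

theorem multiplicativelyIndependent_pair {K : Type*} [Field K] {x y : K} :
    MultiplicativelyIndependent ![x, y] ↔
      (x ≠ 0 ∧ y ≠ 0) ∧ ∀ a b : ℤ, x ^ a * y ^ b = 1 → a = 0 ∧ b = 0 := by
  constructor
  · rintro ⟨h0, h⟩
    refine ⟨⟨h0 0, h0 1⟩, fun a b hab => ?_⟩
    have := h ![a, b] (by simpa [Fin.prod_univ_two] using hab)
    exact ⟨this 0, this 1⟩
  · rintro ⟨⟨hx, hy⟩, h⟩
    refine ⟨fun i => by fin_cases i <;> assumption, fun e he => ?_⟩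
    have := h (e 0) (e 1) (by simpa [Fin.prod_univ_two] using he)
    intro i
    fin_cases i
    exacts [this.1, this.2]

theorem multiplicativelyIndependent_triple {K : Type*} [Field K] {x y z : K} :
    MultiplicativelyIndependent ![x, y, z] ↔ (x ≠ 0 ∧ y ≠ 0 ∧ z ≠ 0) ∧
      ∀ a b c : ℤ, x ^ a * y ^ b * z ^ c = 1 → a = 0 ∧ b = 0 ∧ c = 0 := by
  constructor
  · rintro ⟨h0, h⟩
    refine ⟨⟨h0 0, h0 1, h0 2⟩, fun a b c hab => ?_⟩
    have := h ![a, b, c] (by simpa [Fin.prod_univ_three] using hab)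
    exact ⟨this 0, this 1, this 2⟩
  · rintro ⟨⟨hx, hy, hz⟩, h⟩
    refine ⟨fun i => by fin_cases i <;> assumption, fun e he => ?_⟩
    have := h (e 0) (e 1) (e 2) (by simpa [Fin.prod_univ_three] using he)
    intro i
    fin_cases i
    exacts [this.1, this.2.1, this.2.2]

open GoldenField in
theorem multiplicativelyIndependent_goldenRatio_of_absNorm {x y : GoldenField}
    (hx : toReal x ≠ 0) (hy : toReal y ≠ 0) (h : IndependentPair (absNorm x) (absNorm y)) :
    MultiplicativelyIndependent ![Real.goldenRatio, toReal x, toReal y] := by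
  refine multiplicativelyIndependent_triple.2
    ⟨⟨Real.goldenRatio_ne_zero, hx, hy⟩, fun a b c habc => ?_⟩
  rw [← toReal_omega] at habc
  have hn := absNorm_relation habc
  rw [absNorm_omega, one_zpow, one_mul] at hn
  obtain ⟨rfl, rfl⟩ := h b c hn
  rw [zpow_zero, zpow_zero, mul_one, mul_one, toReal_omega] at habc
  exact ⟨zpow_goldenRatio_eq_one habc, rfl, rfl⟩

open GoldenField in
theorem multiplicativelyIndependent_goldenRatio_tau_iff {t : ℕ} (ht : 0 < t) :
    MultiplicativelyIndependent ![Real.goldenRatio, _root_.tau t] ↔ t ≠ 2 := by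
  rw [multiplicativelyIndependent_pair]
  constructor
  · rintro ⟨⟨h0, -⟩, h⟩ rfl
    have := h 1 (-1) (by simp only [tau_two, zpow_one, zpow_neg, mul_inv_cancel₀ h0])
    omega
  · intro h2
    refine ⟨⟨Real.goldenRatio_ne_zero, (tau_pos t).ne'⟩, fun a b hab => ?_⟩
    have hn := absNorm_relation (x := QuadraticAlgebra.omega) (y := tau t) (z := 1)
      (a := a) (b := b) (c := 0) (by rwa [toReal_omega, toReal_tau, zpow_zero, mul_one])
    rw [absNorm_omega, one_zpow, one_mul, zpow_zero, mul_one] at hn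
    have hb : b = 0 :=
      (zpow_eq_one_iff_right₀ (by rw [absNorm_apply]; positivity) (absNorm_tau_ne_one ht h2)).1 hn
    rw [hb, zpow_zero, mul_one] at hab
    exact ⟨zpow_goldenRatio_eq_one hab, hb⟩

theorem tau_one_sq_mul_tau_ten : tau 1 ^ 2 * tau 10 = Real.goldenRatio ^ 9 := by
  have h := congrArg (· ^ 2) sqrt_five_mul_tau_one
  simp only [mul_pow, Real.sq_sqrt (show (0 : ℝ) ≤ 5 by norm_num)] at h
  rw [tau_ten]
  linear_combination Real.goldenRatio ^ 5 * h

theorem multiplicativelyIndependent_goldenRatio_tau_tau_iff {s t : ℕ} (hs : 0 < s) (hst : s < t) :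
    MultiplicativelyIndependent ![Real.goldenRatio, tau s, tau t] ↔
      ¬ (s = 2 ∨ t = 2 ∨ (s = 1 ∧ t = 10)) := by
  constructor
  · intro hI
    obtain ⟨⟨h0, -⟩, h⟩ := multiplicativelyIndependent_triple.1 hI
    rintro (rfl | rfl | ⟨rfl, rfl⟩)
    · have := h 1 (-1) 0 (by
        simp only [tau_two, zpow_one, zpow_neg, zpow_zero, mul_one, mul_inv_cancel₀ h0])
      omega
    · have := h 1 0 (-1) (by
        simp only [tau_two, zpow_one, zpow_neg, zpow_zero, mul_one, mul_inv_cancel₀ h0])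
      omega
    · have := h (-9) 2 1 (by
        rw [mul_assoc, zpow_one, zpow_ofNat, tau_one_sq_mul_tau_ten, ← zpow_natCast,
          ← zpow_add₀ h0]
        norm_num)
      omega
  · intro h
    have := multiplicativelyIndependent_goldenRatio_of_absNorm
      (by rw [GoldenField.toReal_tau]; exact (tau_pos s).ne')
      (by rw [GoldenField.toReal_tau]; exact (tau_pos t).ne')
      (independentPair_absNorm_tau hs hst h)
    rwa [GoldenField.toReal_tau, GoldenField.toReal_tau] at this

theorem multiplicativelyIndependent_goldenRatio_sqrt_five_tau_iff {t : ℕ} (ht : 0 < t) :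
    MultiplicativelyIndependent ![Real.goldenRatio, √5, tau t] ↔
      ¬ (t = 1 ∨ t = 2 ∨ t = 10) := by
  have hs : √5 ≠ 0 := by positivity
  constructor
  · intro hI
    obtain ⟨⟨h0, -, ht0⟩, h⟩ := multiplicativelyIndependent_triple.1 hI
    rintro (rfl | rfl | rfl)
    · have := h (-2) 1 1 (by
        rw [mul_assoc, zpow_one, zpow_one, sqrt_five_mul_tau_one, ← zpow_natCast, ← zpow_add₀ h0]
        norm_num)
      omega
    · have := h 1 0 (-1) (by
        simp only [tau_two, zpow_one, zpow_neg, zpow_zero, mul_one, mul_inv_cancel₀ h0])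
      omega
    · have := h 5 2 (-1) (by
        rw [zpow_neg, zpow_one, mul_inv_eq_one₀ ht0, tau_ten, zpow_ofNat, zpow_ofNat,
          Real.sq_sqrt (by norm_num), mul_comm])
      omega
  · intro h
    have := multiplicativelyIndependent_goldenRatio_of_absNorm
      (x := GoldenField.sqrtFive) (y := GoldenField.tau t)
      (by rwa [GoldenField.toReal_sqrtFive])
      (by rw [GoldenField.toReal_tau]; exact (tau_pos t).ne')
      (by rw [GoldenField.absNorm_sqrtFive]; exact independentPair_five_absNorm_tau ht h)
    rwa [GoldenField.toReal_sqrtFive, GoldenField.toReal_tau] at this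

open GoldenField in
-- The norms 5⁻¹ and 5² are dependent and give only a = 2b; the relation is then φ^(9b) = 1.
theorem multiplicativelyIndependent_tau_one_tau_ten :
    MultiplicativelyIndependent ![_root_.tau 1, _root_.tau 10] := by
  refine multiplicativelyIndependent_pair.2 ⟨⟨(tau_pos 1).ne', (tau_pos 10).ne'⟩,
    fun a b hab => ?_⟩
  have hn := absNorm_relation (x := tau 1) (y := tau 10) (z := 1)
    (a := a) (b := b) (c := 0) (by rwa [toReal_tau, toReal_tau, zpow_zero, mul_one])
  have h1 : absNorm (tau 1) = (5 : ℚ) ^ (-1 : ℤ) := by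
    rw [absNorm_tau one_pos, show powAddOneNorm 1 = 1 by decide]; norm_num
  have h10 : absNorm (tau 10) = (5 : ℚ) ^ (2 : ℤ) := by
    rw [absNorm_tau (by norm_num), show powAddOneNorm 10 = 125 by decide]; norm_num
  rw [zpow_zero, mul_one, h1, h10, ← zpow_mul, ← zpow_mul, ← zpow_add₀ (by norm_num),
    zpow_eq_one_iff_right₀ (by norm_num) (by norm_num)] at hn
  obtain rfl : a = 2 * b := by linarith
  rw [zpow_mul, zpow_ofNat, ← mul_zpow, tau_one_sq_mul_tau_ten, ← zpow_natCast, ← zpow_mul] at hab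
  have := zpow_goldenRatio_eq_one hab
  omega

/-- Outside the exceptional cases, φ is dropped from an independent triple. If an index is 2, then
τ(2) = φ reduces the claim to the pair with φ. -/
theorem multiplicativelyIndependent_tau_tau {s t : ℕ} (hs : 0 < s) (hst : s < t) :
    MultiplicativelyIndependent ![tau s, tau t] := by
  by_cases h : s = 2 ∨ t = 2 ∨ (s = 1 ∧ t = 10)
  · rcases h with rfl | rfl | ⟨rfl, rfl⟩
    · rw [tau_two]
      exact (multiplicativelyIndependent_goldenRatio_tau_iff (by omega)).2 (by omega)
    · rw [tau_two, multiplicativelyIndependent_pair]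
      have := multiplicativelyIndependent_pair.1
        ((multiplicativelyIndependent_goldenRatio_tau_iff hs).2 hst.ne)
      exact ⟨this.1.symm, fun a b hab => (this.2 b a (by rwa [mul_comm])).symm⟩
    · exact multiplicativelyIndependent_tau_one_tau_ten
  · have := multiplicativelyIndependent_triple.1
      ((multiplicativelyIndependent_goldenRatio_tau_tau_iff hs hst).2 h)
    exact multiplicativelyIndependent_pair.2
      ⟨this.1.2, fun a b hab => (this.2 0 a b (by rwa [zpow_zero, one_mul])).2⟩

theorem mainTheorem4 :
    (∀ t : ℕ, 0 < t →
      (MultiplicativelyIndependent ![Real.goldenRatio, tau t] ↔ t ≠ 2)) ∧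
    (∀ t₁ t₂ : ℕ, 0 < t₁ → t₁ < t₂ →
      MultiplicativelyIndependent ![tau t₁, tau t₂]) ∧
    (∀ t₁ t₂ : ℕ, 0 < t₁ → t₁ < t₂ →
      (MultiplicativelyIndependent ![Real.goldenRatio, tau t₁, tau t₂] ↔
        ¬ (t₁ = 2 ∨ t₂ = 2 ∨ (t₁ = 1 ∧ t₂ = 10)))) ∧
    (∀ t : ℕ, 0 < t →
      (MultiplicativelyIndependent ![Real.goldenRatio, √5, tau t] ↔
        ¬ (t = 1 ∨ t = 2 ∨ t = 10))) := by
  exact ⟨fun _ => multiplicativelyIndependent_goldenRatio_tau_iff,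
    fun _ _ => multiplicativelyIndependent_tau_tau,
    fun _ _ => multiplicativelyIndependent_goldenRatio_tau_tau_iff,
    fun _ => multiplicativelyIndependent_goldenRatio_sqrt_five_tau_iff⟩
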